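/- Let $(\Omega,\mathcal F,\mathbb Q)$ be a probability space ($\mathbb Q$ the risk-neutral measure, $\mathbb E$ its expectation). Let $u\mapsto P_{0u}$ on $[0,\infty)$ be a differentiable, strictly decreasing discount function with $P_{00}=1$, $0<P_{0u}\le 1$, $\lim_{u\to\infty}P_{0u}=0$, and put $P_{su}=P_{0u}/P_{0s}$. Let $0\le t<T$, $\sigma>0$ and $h_0<h_1$. A binary defaultable discount bond pays $H_T$ at time $T$, where $\mathbb Q(H_T=h_i)=p_i>0$ $(i=0,1)$ and $p_0+p_1=1$. Let $\{\beta_{uT}\}_{0\le u\le T}$ be a standard Brownian bridge on $[0,T]$ (a continuous centred Gaussian process vanishing at $0$ and $T$ with $\mathbb E[\beta_{rT}\beta_{uT}]=r(T-u)/T$ for $0\le r\le u\le T$), independent of $H_T$, let $\xi_u=\sigma H_T u+\beta_{uT}$ be the market information process, and let $\mathcal F_s=\sigma(\xi_u:0\le u\le s)$ be the market filtration. The bond price is $B_{tT}=P_{tT}\,\mathbb E[H_T\mid\mathcal F_t]$, and the price at time $s\le t$ of the European call with strike $K$ and expiry $t$ is $C_s=P_{st}\,\mathbb E[(B_{tT}-K)^+\mid\mathcal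 F_s]$. Assume $P_{tT}h_0<K<P_{tT}h_1$. Then, for every $s\in[0,t]$, the posterior probabilities of the payoffs are almost surely $$\mathbb Q(H_T=h_i\mid\mathcal F_s)=\pi_{is}:=\frac{p_i\exp\left[\frac{T}{T-s}\left(\sigma h_i\xi_s-\tfrac12\sigma^2h_i^2s\right)\right]}{\sum_{j=0}^1p_j\exp\left[\frac{T}{T-s}\left(\sigma h_j\xi_s-\tfrac12\sigma^2h_j^2s\right)\right]}\qquad(i=0,1),$$ and the option price is almost surely $$C_s=P_{st}\Big[\pi_{1s}\left(P_{tT}h_1-K\right)N(d_s^+)-\pi_{0s}\left(K-P_{tT}h_0\right)N(d_s^-)\Big],$$ where $N$ is the standard normal distribution function and $$d_s^{\pm}=\frac{\ln\left[\frac{\pi_{1s}(P_{tT}h_1-K)}{\pi_{0s}(K-P_{tT}h_0)}\right]\pm\tfrac12\sigma^2v_{st}^2T^2(h_1-h_0)^2}{\sigma v_{st}T(h_1-h_0)},\qquad v_{st}=\sqrt{\frac{t-s}{(T-t)(T-s)}}.$$ At $s=t$, where $v_{tt}=0$, the right-hand side of the price formula is understood as its limit when $v_{tt}$ is replaced by $v$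 (with $\pi_{it}$ fixed) and $v\downarrow 0$. -/

import Mathlib

open MeasureTheory ProbabilityTheory Filter Topology

noncomputable section

namespace BinaryBond

/-- The initial discount function `t ↦ P_{0t}` of a deterministic default-free interest rate
system. -/
structure IsDiscountFunction (P₀ : ℝ → ℝ) : Prop where
  zero : P₀ 0 = 1
  differentiable : DifferentiableOn ℝ P₀ (Set.Ici 0)
  strictAnti : StrictAntiOn P₀ (Set.Ici 0)
  pos : ∀ u, 0 ≤ u → 0 < P₀ u
  le_one : ∀ u, 0 ≤ u → P₀ u ≤ 1
  tendsto_zero : Tendsto P₀ atTop (𝓝 0)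

/-- The discount factor `P_{su} = P_{0u} / P_{0s}`. -/
def discount (P₀ : ℝ → ℝ) (s u : ℝ) : ℝ := P₀ u / P₀ s

/-- `β` is a standard Brownian bridge on the time interval `[0, T]`, from `0` to `0`. Only the
values `β u` with `u ∈ [0, T]` matter. -/
structure IsBrownianBridge {Ω : Type*} [MeasurableSpace Ω] (β : ℝ → Ω → ℝ) (T : ℝ)
    (Q : Measure Ω) : Prop where
  measurable : ∀ u ∈ Set.Icc 0 T, Measurable (β u)
  gaussian : IsGaussianProcess (fun u : Set.Icc (0 : ℝ) T ↦ β u) Q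
  start : ∀ᵐ ω ∂Q, β 0 ω = 0
  finish : ∀ᵐ ω ∂Q, β T ω = 0
  mean : ∀ u ∈ Set.Icc 0 T, ∫ ω, β u ω ∂Q = 0
  covariance : ∀ r u, 0 ≤ r → r ≤ u → u ≤ T → ∫ ω, β r ω * β u ω ∂Q = r * (T - u) / T
  continuous_paths : ∀ᵐ ω ∂Q, ContinuousOn (fun u ↦ β u ω) (Set.Icc 0 T)

/-- The market information process `ξ_u = σ H u + β_u`. -/
def info {Ω : Type*} (σ : ℝ) (H : Ω → ℝ) (β : ℝ → Ω → ℝ) (u : ℝ) (ω : Ω) : ℝ :=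
  σ * H ω * u + β u ω

/-- The σ-algebra generated by the information process up to time `s`. -/
@[reducible] def marketInfo {Ω : Type*} (σ : ℝ) (H : Ω → ℝ) (β : ℝ → Ω → ℝ) (s : ℝ) : MeasurableSpace Ω :=
  ⨆ u ∈ Set.Icc (0 : ℝ) s, MeasurableSpace.comap (info σ H β u) inferInstance

/-- The information σ-algebras are sub-σ-algebras of the given one, so that conditional
expectations with respect to them are meaningful. -/
theorem marketInfo_le {Ω : Type*} [mΩ : MeasurableSpace Ω] {σ s T : ℝ} {H : Ω → ℝ}
    {β : ℝ → Ω → ℝ} (hH : Measurable H) (hβ : ∀ u ∈ Set.Icc 0 T, Measurable (β u))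
    (hs : s ≤ T) : marketInfo σ H β s ≤ mΩ := by
  refine iSup₂_le fun u hu ↦ ?_
  have h1 : Measurable (β u) := hβ u ⟨hu.1, hu.2.trans hs⟩
  have h2 : Measurable (info σ H β u) := by
    unfold info
    fun_prop
  exact h2.comap_le

theorem marketInfo_mono {Ω : Type*} {σ : ℝ} {H : Ω → ℝ} {β : ℝ → Ω → ℝ} :
    Monotone (marketInfo σ H β) := fun _ _ h ↦
  biSup_mono fun _ hu ↦ ⟨hu.1, hu.2.trans h⟩

/-- The price at time `t` of the bond paying `H` at time `T`:
`B_{tT} = P_{tT} 𝔼[H | F_t]`. -/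
def bondPrice {Ω : Type*} [MeasurableSpace Ω] (Q : Measure Ω) (P₀ : ℝ → ℝ) (σ T : ℝ)
    (H : Ω → ℝ) (β : ℝ → Ω → ℝ) (t : ℝ) (ω : Ω) : ℝ :=
  discount P₀ t T * (Q[H | marketInfo σ H β t]) ω

/-- The price at time `s` of the European call with strike `K` and expiry `t` on the bond:
`C_s = P_{st} 𝔼[(B_{tT} - K)⁺ | F_s]`. -/
def callPrice {Ω : Type*} [MeasurableSpace Ω] (Q : Measure Ω) (P₀ : ℝ → ℝ) (σ T : ℝ)
    (H : Ω → ℝ) (β : ℝ → Ω → ℝ) (K t s : ℝ) (ω : Ω) : ℝ :=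
  discount P₀ s t *
    (Q[fun ω' ↦ max (bondPrice Q P₀ σ T H β t ω' - K) 0 | marketInfo σ H β s]) ω

/-- The unnormalised posterior weight `p_{iu}` of the payoff `h i` when `ξ_u = x`. -/
def weight (σ T : ℝ) (p h : Fin 2 → ℝ) (i : Fin 2) (u x : ℝ) : ℝ :=
  p i * Real.exp (T / (T - u) * (σ * h i * x - 1 / 2 * σ ^ 2 * h i ^ 2 * u))

/-- The posterior probability `π_{iu}` of the payoff `h i` when `ξ_u = x`. -/
def posterior (σ T : ℝ) (p h : Fin 2 → ℝ) (i : Fin 2) (u x : ℝ) : ℝ :=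
  weight σ T p h i u x / ∑ j, weight σ T p h j u x

/-- `v_{st}`, the square root of `(t - s) / ((T - t) (T - s))`. -/
def vol (T s t : ℝ) : ℝ := Real.sqrt ((t - s) / ((T - t) * (T - s)))

/-- `d⁺ = (ln (a₁ / a₀) + ½ c²) / c`; it is used with `c = σ v_{st} T (h₁ - h₀)`. -/
def dPlus (a₀ a₁ c : ℝ) : ℝ := (Real.log (a₁ / a₀) + 1 / 2 * c ^ 2) / c

/-- `d⁻ = (ln (a₁ / a₀) - ½ c²) / c`; it is used with `c = σ v_{st} T (h₁ - h₀)`. -/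
def dMinus (a₀ a₁ c : ℝ) : ℝ := (Real.log (a₁ / a₀) - 1 / 2 * c ^ 2) / c

/-- The standard normal distribution function. -/
def N (x : ℝ) : ℝ := cdf (gaussianReal 0 1) x

/-- The Black-Scholes type expression `a₁ N(d⁺) - a₀ N(d⁻)`. -/
def blackScholes (a₀ a₁ c : ℝ) : ℝ := a₁ * N (dPlus a₀ a₁ c) - a₀ * N (dMinus a₀ a₁ c)

end BinaryBond

end

noncomputable section

namespace BinaryBond

/-! The bridge splits into three independent Gaussian pieces: `β s`, the `residual` path on `[0,
s]`, and the `innovation` that carries it on to time `t`. The signal `σ H u` is linear in `u`, so it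
cancels from `ξ_u - (u/s) ξ_s`; hence all information up to `s` lies in `ξ_s` and the residual, and
the residual is independent of `H`. Given `H = h i`, `ξ_s` is `β s` shifted by `σ h_i s`, and the
Cameron–Martin density of this shift, times `p i`, is `weight`. Bayes' formula follows by testing on
events of the filtration (`condExp_indicator_payoff`).

For the call, the ratio of the posteriors increases with `ξ_t`, so exercise means that `ξ_t` exceeds
a threshold. On that event the payoff is a conditional expectation of a combination of the
indicators of `H = h i`; the tower property moves it to time `s`. There, for each `h i`, exercise
becomes a half-line event for the innovation, whose Gaussian probability is `N` at `dPlus` or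
`dMinus`. At `s = t` the claim is the limit `tendsto_blackScholes`. -/

theorem isGaussianProcess_sub_mul {Ω S T : Type*} [MeasurableSpace Ω] {Q : Measure Ω}
    {X : T → Ω → ℝ} (hX : IsGaussianProcess X Q) (a b : S → T) (c : S → ℝ) :
    IsGaussianProcess (fun i ω ↦ X (a i) ω - c i * X (b i) ω) Q := by
  classical
  exact hX.of_isGaussianProcess fun i ↦ ⟨{a i, b i},
    { toFun x := x ⟨a i, by simp⟩ - c i * x ⟨b i, by simp⟩
      map_add' x y := by simp; ring
      map_smul' r x := by simp; ring
      cont := by fun_prop },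
    by simp⟩

/-- The part of the bridge on `[0, s]` that is independent of its value at `s`. -/
def residual {Ω : Type*} (β : ℝ → Ω → ℝ) (s : ℝ) (ω : Ω) (u : Set.Icc (0 : ℝ) s) : ℝ :=
  β u ω - u / s * β s ω

/-- The part of the bridge value at time `t` that is independent of the bridge up to time `s`. -/
def innovation {Ω : Type*} (β : ℝ → Ω → ℝ) (T s t : ℝ) (ω : Ω) : ℝ :=
  β t ω - (T - t) / (T - s) * β s ω

/-! ### Independent Gaussian pieces of the bridge. -/

namespace IsBrownianBridge

variable {Ω : Type*} [MeasurableSpace Ω] {Q : Measure Ω}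
  {β : ℝ → Ω → ℝ} {T s t : ℝ}

theorem hasGaussianLaw (hβ : IsBrownianBridge β T Q) {u : ℝ} (hu : u ∈ Set.Icc 0 T) :
    HasGaussianLaw (β u) Q :=
  hβ.gaussian.hasGaussianLaw_eval ⟨u, hu⟩

theorem measurable_residual (hβ : IsBrownianBridge β T Q) (hs : 0 ≤ s) (hsT : s < T) :
    Measurable (residual β s) := by
  refine measurable_pi_lambda _ fun u ↦ ?_
  have h1 := hβ.measurable s ⟨hs, hsT.le⟩
  have h2 := hβ.measurable u ⟨u.2.1, u.2.2.trans hsT.le⟩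
  unfold residual
  fun_prop

theorem measurable_innovation (hβ : IsBrownianBridge β T Q) (hs : 0 ≤ s) (hst : s ≤ t)
    (htT : t < T) : Measurable (innovation β T s t) := by
  have h1 := hβ.measurable s ⟨hs, hst.trans htT.le⟩
  have h2 := hβ.measurable t ⟨hs.trans hst, htT.le⟩
  unfold innovation
  fun_prop

theorem memLp_two (hβ : IsBrownianBridge β T Q) {u : ℝ} (hu : u ∈ Set.Icc 0 T) :
    MemLp (β u) 2 Q :=
  (hβ.hasGaussianLaw hu).memLp_two

theorem cov_eq (hβ : IsBrownianBridge β T Q) {r u : ℝ} (hr : 0 ≤ r) (hru : r ≤ u) (hu : u ≤ T) :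
    cov[β r, β u; Q] = r * (T - u) / T := by
  rw [ProbabilityTheory.covariance, hβ.mean r ⟨hr, hru.trans hu⟩, hβ.mean u ⟨hr.trans hru, hu⟩]
  simpa using hβ.covariance r u hr hru hu

theorem map_eval (hβ : IsBrownianBridge β T Q) (hs : 0 ≤ s) (hsT : s < T) :
    Q.map (β s) = gaussianReal 0 (s * (T - s) / T).toNNReal := by
  rw [(hβ.hasGaussianLaw ⟨hs, hsT.le⟩).map_eq_gaussianReal, hβ.mean s ⟨hs, hsT.le⟩,
    ← covariance_self (hβ.measurable s ⟨hs, hsT.le⟩).aemeasurable, hβ.cov_eq hs le_rfl hsT.le]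

variable [IsProbabilityMeasure Q]

theorem cov_sub_mul_left (hβ : IsBrownianBridge β T Q) {r u v c : ℝ} (hr : r ∈ Set.Icc 0 T)
    (hu : u ∈ Set.Icc 0 T) (hv : v ∈ Set.Icc 0 T) :
    cov[fun ω ↦ β r ω - c * β u ω, β v; Q] = cov[β r, β v; Q] - c * cov[β u, β v; Q] := by
  rw [covariance_fun_sub_left (hβ.memLp_two hr) ((hβ.memLp_two hu).const_mul c) (hβ.memLp_two hv),
    covariance_const_mul_left]

/-- For `u ≤ s` the covariances with `β t` and `β s` have ratio `(T - t) / (T - s)`, whatever `u`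
is. This is the Markov property of the bridge. -/
theorem cov_innovation (hβ : IsBrownianBridge β T Q) {u : ℝ} (hu : 0 ≤ u) (hus : u ≤ s)
    (hst : s ≤ t) (htT : t < T) : cov[innovation β T s t, β u; Q] = 0 := by
  have hs : 0 ≤ s := hu.trans hus
  have h1 : T - s ≠ 0 := by linarith
  unfold innovation
  rw [hβ.cov_sub_mul_left ⟨by linarith, by linarith⟩ ⟨by linarith, by linarith⟩
    ⟨by linarith, by linarith⟩, covariance_comm, hβ.cov_eq hu (by linarith) htT.le,
    covariance_comm, hβ.cov_eq hu hus (by linarith)]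
  field_simp
  ring

theorem cov_residual (hβ : IsBrownianBridge β T Q) (hsT : s < T) (u : Set.Icc (0 : ℝ) s) :
    cov[fun ω ↦ residual β s ω u, β s; Q] = 0 := by
  obtain ⟨u, hu, hus⟩ := u
  have hs : 0 ≤ s := hu.trans hus
  simp only [residual]
  rw [hβ.cov_sub_mul_left ⟨by linarith, by linarith⟩ ⟨by linarith, by linarith⟩
    ⟨by linarith, by linarith⟩, hβ.cov_eq hu hus hsT.le, hβ.cov_eq hs le_rfl hsT.le]
  -- At `s = 0` the quotient `u / s` is `0` and `u` is forced to be `0`.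
  rcases hs.eq_or_lt with rfl | hs
  · simp [le_antisymm hus hu]
  · field_simp
    ring

theorem indepFun_residual (hβ : IsBrownianBridge β T Q) (hs : 0 ≤ s) (hsT : s < T) :
    IndepFun (β s) (residual β s) Q := by
  have hm := hβ.measurable_residual hs hsT
  have hms := hβ.measurable s ⟨hs, hsT.le⟩
  let s' : Set.Icc (0 : ℝ) T := ⟨s, hs, hsT.le⟩
  let a : Unit ⊕ Set.Icc (0 : ℝ) s → Set.Icc (0 : ℝ) T :=
    Sum.elim (fun _ ↦ s') fun u ↦ ⟨u, u.2.1, u.2.2.trans hsT.le⟩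
  -- The coefficient `0` leaves `β s` itself unchanged, so one joint Gaussian family holds both
  -- sides.
  let c : Unit ⊕ Set.Icc (0 : ℝ) s → ℝ := Sum.elim (fun _ ↦ 0) fun u ↦ u / s
  have hG : IsGaussianProcess
      (Sum.elim (fun _ : Unit ↦ β s) fun u ω ↦ residual β s ω u) Q := by
    convert! isGaussianProcess_sub_mul hβ.gaussian a (fun _ ↦ s') c using 1
    ext i ω
    cases i <;> simp [a, c, s', residual]
  have h := hG.indepFun_of_covariance_eq_zero (fun _ ↦ hms.aemeasurable)
    (fun u ↦ (measurable_pi_iff.1 hm u).aemeasurable) fun _ u ↦ by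
      rw [covariance_comm]
      exact hβ.cov_residual hsT u
  exact h.comp (measurable_pi_apply ()) measurable_id

theorem indepFun_innovation (hβ : IsBrownianBridge β T Q) (hs : 0 ≤ s) (hst : s ≤ t)
    (htT : t < T) :
    IndepFun (fun ω ↦ (β s ω, residual β s ω)) (innovation β T s t) Q := by
  have hsT : s < T := hst.trans_lt htT
  have hm := hβ.measurable_innovation hs hst htT
  let s' : Set.Icc (0 : ℝ) T := ⟨s, hs, hsT.le⟩
  let t' : Set.Icc (0 : ℝ) T := ⟨t, hs.trans hst, htT.le⟩
  let a : Set.Icc (0 : ℝ) s ⊕ Unit → Set.Icc (0 : ℝ) T :=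
    Sum.elim (fun u ↦ ⟨u, u.2.1, u.2.2.trans hsT.le⟩) fun _ ↦ t'
  let c : Set.Icc (0 : ℝ) s ⊕ Unit → ℝ := Sum.elim (fun _ ↦ 0) fun _ ↦ (T - t) / (T - s)
  have hG : IsGaussianProcess
      (Sum.elim (fun u : Set.Icc (0 : ℝ) s ↦ β u) fun _ : Unit ↦ innovation β T s t) Q := by
    convert! isGaussianProcess_sub_mul hβ.gaussian a (fun _ ↦ s') c using 1
    ext i ω
    cases i <;> simp [a, c, s', t', innovation]
  have h := hG.indepFun_of_covariance_eq_zero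
    (fun u ↦ (hβ.measurable u ⟨u.2.1, u.2.2.trans hsT.le⟩).aemeasurable)
    (fun _ ↦ hm.aemeasurable) fun u _ ↦ by
      rw [covariance_comm]
      exact hβ.cov_innovation u.2.1 u.2.2 hst htT
  have hφ : Measurable fun x : Set.Icc (0 : ℝ) s → ℝ ↦
      (x ⟨s, hs, le_rfl⟩, fun u : Set.Icc (0 : ℝ) s ↦ x u - u / s * x ⟨s, hs, le_rfl⟩) := by
    refine Measurable.prodMk (by fun_prop) (measurable_pi_lambda _ fun u ↦ by fun_prop)
  exact h.comp hφ (measurable_pi_apply ())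

theorem map_innovation (hβ : IsBrownianBridge β T Q) (hs : 0 ≤ s) (hst : s ≤ t) (htT : t < T) :
    Q.map (innovation β T s t)
      = gaussianReal 0 ((T - t) * (t - s) / (T - s)).toNNReal := by
  have hsT : s < T := hst.trans_lt htT
  have hm := hβ.measurable_innovation hs hst htT
  have hs' : s ∈ Set.Icc 0 T := ⟨hs, hsT.le⟩
  have ht' : t ∈ Set.Icc 0 T := ⟨hs.trans hst, htT.le⟩
  have hG : HasGaussianLaw (innovation β T s t) Q :=
    (isGaussianProcess_sub_mul hβ.gaussian (fun _ : Unit ↦ ⟨t, ht'⟩) (fun _ ↦ ⟨s, hs'⟩)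
      fun _ ↦ (T - t) / (T - s)).hasGaussianLaw_eval ()
  have hL : MemLp (innovation β T s t) 2 Q := hG.memLp_two
  have hmean : ∫ ω, innovation β T s t ω ∂Q = 0 := by
    unfold innovation
    rw [integral_sub (hβ.hasGaussianLaw ht').integrable
      ((hβ.hasGaussianLaw hs').integrable.const_mul _), integral_const_mul, hβ.mean t ht',
      hβ.mean s hs']
    simp
  have hvar : Var[innovation β T s t; Q] = (T - t) * (t - s) / (T - s) := by
    rw [← covariance_self hm.aemeasurable]
    -- The innovation is uncorrelated with `β s`, so its variance is its covariance with `β t`.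
    have h1 : cov[innovation β T s t, innovation β T s t; Q]
        = cov[innovation β T s t, β t; Q] - (T - t) / (T - s) * cov[innovation β T s t, β s; Q] := by
      rw [← covariance_const_mul_right, ← covariance_fun_sub_right hL (hβ.memLp_two ht')
        ((hβ.memLp_two hs').const_mul _)]
      rfl
    have h2 : T ≠ 0 := by linarith
    have h3 : T - s ≠ 0 := by linarith
    rw [h1, hβ.cov_innovation hs le_rfl hst htT]
    unfold innovation
    rw [hβ.cov_sub_mul_left ht' hs' ht', hβ.cov_eq hs hst htT.le,
      hβ.cov_eq (hs.trans hst) le_rfl htT.le]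
    field_simp
    ring
  rw [hG.map_eq_gaussianReal, hmean, hvar]

theorem map_prod (hβ : IsBrownianBridge β T Q) (hs : 0 ≤ s) (hst : s ≤ t) (htT : t < T) :
    Q.map (fun ω ↦ ((β s ω, residual β s ω), innovation β T s t ω))
      = ((gaussianReal 0 (s * (T - s) / T).toNNReal).prod (Q.map (residual β s))).prod
          (gaussianReal 0 ((T - t) * (t - s) / (T - s)).toNNReal) := by
  have hsT : s < T := hst.trans_lt htT
  have h1 := hβ.measurable s ⟨hs, hsT.le⟩
  have h2 := hβ.measurable_residual hs hsT
  have h3 := hβ.measurable_innovation hs hst htT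
  rw [(indepFun_iff_map_prod_eq_prod_map_map (h1.prodMk h2).aemeasurable h3.aemeasurable).1
      (hβ.indepFun_innovation hs hst htT),
    (indepFun_iff_map_prod_eq_prod_map_map h1.aemeasurable h2.aemeasurable).1
      (hβ.indepFun_residual hs hsT), hβ.map_eval hs hsT, hβ.map_innovation hs hst htT]

end IsBrownianBridge

/-- Cameron–Martin in one dimension. Writing the shift as `v * a` keeps the identity valid for the
Dirac mass `v = 0`, which occurs at `s = 0`. -/
theorem integral_gaussianReal_translate (v : NNReal) (a : ℝ) (f : ℝ → ℝ) :
    ∫ x, f (v * a + x) ∂gaussianReal 0 v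
      = ∫ x, Real.exp (a * x - v * a ^ 2 / 2) * f x ∂gaussianReal 0 v := by
  rcases eq_or_ne v 0 with rfl | hv
  · simp
  · rw [integral_gaussianReal_eq_integral_smul hv, integral_gaussianReal_eq_integral_smul hv,
      ← integral_add_left_eq_self _ (-(v * a))]
    refine integral_congr_ae (.of_forall fun x ↦ ?_)
    have hv' : (v : ℝ) ≠ 0 := by exact_mod_cast hv
    have h : Real.exp (-(-(v * a) + x) ^ 2 / (2 * v))
        = Real.exp (-x ^ 2 / (2 * v)) * Real.exp (a * x - v * a ^ 2 / 2) := by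
      rw [← Real.exp_add]
      congr 1
      field_simp
      ring
    simp only [gaussianPDFReal, smul_eq_mul, sub_zero, add_neg_cancel_left, h]
    ring

/-! ### Posterior weights as Gaussian shift densities. -/

section Weight

variable {σ T s : ℝ} {p h : Fin 2 → ℝ}

theorem weight_pos (hp : ∀ i, 0 < p i) (i : Fin 2) (u x : ℝ) : 0 < weight σ T p h i u x :=
  mul_pos (hp i) (Real.exp_pos _)

theorem sum_weight_pos (hp : ∀ i, 0 < p i) (u x : ℝ) : 0 < ∑ j, weight σ T p h j u x :=
  Finset.sum_pos (fun i _ ↦ weight_pos hp i u x) Finset.univ_nonempty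

theorem posterior_pos (hp : ∀ i, 0 < p i) (i : Fin 2) (u x : ℝ) :
    0 < posterior σ T p h i u x :=
  div_pos (weight_pos hp i u x) (sum_weight_pos hp u x)

theorem posterior_le_one (hp : ∀ i, 0 < p i) (i : Fin 2) (u x : ℝ) :
    posterior σ T p h i u x ≤ 1 :=
  div_le_one_of_le₀ (Finset.single_le_sum (fun j _ ↦ (weight_pos hp j u x).le)
    (Finset.mem_univ i)) (sum_weight_pos hp u x).le

theorem sum_weight_mul_posterior (hp : ∀ i, 0 < p i) (i : Fin 2) (u x : ℝ) :
    ∑ j, weight σ T p h j u x * posterior σ T p h i u x = weight σ T p h i u x := by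
  rw [← Finset.sum_mul, posterior, mul_div_cancel₀ _ (sum_weight_pos hp u x).ne']

@[fun_prop]
theorem measurable_weight (i : Fin 2) (u : ℝ) : Measurable (weight σ T p h i u) := by
  unfold weight
  fun_prop

@[fun_prop]
theorem measurable_posterior (i : Fin 2) (u : ℝ) : Measurable (posterior σ T p h i u) := by
  unfold posterior
  fun_prop

theorem integrable_weight (i : Fin 2) (u : ℝ) (v : NNReal) :
    Integrable (weight σ T p h i u) (gaussianReal 0 v) := by
  have h1 := (integrable_exp_mul_gaussianReal (μ := 0) (v := v)
    (T / (T - u) * (σ * h i))).const_mul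
    (p i * Real.exp (-(T / (T - u) * (1 / 2 * σ ^ 2 * h i ^ 2 * u))))
  refine h1.congr (.of_forall fun x ↦ ?_)
  simp only [weight, mul_assoc, ← Real.exp_add]
  congr 2
  ring

/-- With variance `v = s (T - s) / T`, the choice `a = T / (T - s) * σ h_i` makes `v a` the signal
`σ h_i s`, and the exponent of the density becomes that of `weight`. -/
theorem integral_translate_eq_integral_weight (hs : 0 ≤ s) (hsT : s < T) (i : Fin 2)
    (f : ℝ → ℝ) :
    p i * ∫ x, f (σ * h i * s + x) ∂gaussianReal 0 (s * (T - s) / T).toNNReal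
      = ∫ x, weight σ T p h i s x * f x ∂gaussianReal 0 (s * (T - s) / T).toNNReal := by
  have hT : 0 < T := hs.trans_lt hsT
  have hTs : T - s ≠ 0 := by linarith
  have hv : ((s * (T - s) / T).toNNReal : ℝ) = s * (T - s) / T :=
    Real.coe_toNNReal _ (div_nonneg (mul_nonneg hs (by linarith)) hT.le)
  have h1 := integral_gaussianReal_translate (s * (T - s) / T).toNNReal
    (T / (T - s) * (σ * h i)) f
  have h2 : s * (T - s) / T * (T / (T - s) * (σ * h i)) = σ * h i * s := by field_simp
  rw [hv, h2] at h1
  rw [h1, ← integral_const_mul]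
  refine integral_congr_ae (.of_forall fun x ↦ ?_)
  simp only [weight, ← mul_assoc]
  congr 3
  field_simp

end Weight

/-! ### Bayes' formula for the market filtration. -/

section Conditional

variable {Ω : Type*} {σ T s t : ℝ} {h p : Fin 2 → ℝ} {H : Ω → ℝ} {β : ℝ → Ω → ℝ}

theorem measurable_info (hs : 0 ≤ s) : Measurable[marketInfo σ H β s] (info σ H β s) :=
  Measurable.of_comap_le (le_iSup₂_of_le s ⟨hs, le_rfl⟩ le_rfl)

/-- The signal cancels from `ξ_u - (u/s) ξ_s`, leaving the residual of the bridge. Every event of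
the filtration is thus a condition on `ξ_s` and the residual. -/
theorem marketInfo_le_comap (hs : 0 ≤ s) :
    marketInfo σ H β s ≤ MeasurableSpace.comap
      (fun ω ↦ (info σ H β s ω, residual β s ω)) inferInstance := by
  refine iSup₂_le fun u hu ↦ ?_
  have h1 : info σ H β u
      = (fun x : ℝ × (Set.Icc (0 : ℝ) s → ℝ) ↦ x.2 ⟨u, hu⟩ + u / s * x.1)
        ∘ fun ω ↦ (info σ H β s ω, residual β s ω) := by
    ext ω
    simp only [info, residual, Function.comp]
    rcases hs.eq_or_lt with rfl | hs
    · simp [le_antisymm hu.2 hu.1]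
    · field_simp
      ring
  rw [h1, ← MeasurableSpace.comap_comp]
  refine MeasurableSpace.comap_mono (Measurable.comap_le ?_)
  fun_prop

variable [MeasurableSpace Ω] {Q : Measure Ω} [IsProbabilityMeasure Q]

/-- The two disjoint events have total mass one; `H` may take other values on a null set. -/
theorem payoff_ae (hh : h 0 < h 1) (hp_sum : ∑ i, p i = 1) (hH : Measurable H)
    (hHp : ∀ i, Q.real {ω | H ω = h i} = p i) :
    {ω | H ω = h 1} =ᵐ[Q] ({ω | H ω = h 0}ᶜ : Set Ω) := by
  have hE : ∀ i, MeasurableSet {ω | H ω = h i} := fun i ↦ hH (measurableSet_singleton _)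
  have hsub : {ω | H ω = h 1} ⊆ {ω | H ω = h 0}ᶜ := fun ω hω h0 ↦
    hh.ne (h0.symm.trans hω)
  refine ae_eq_of_subset_of_measure_ge hsub (le_of_eq ?_) (hE 1).nullMeasurableSet
    (measure_ne_top _ _)
  rw [← measureReal_eq_measureReal_iff, probReal_compl_eq_one_sub (hE 0), hHp, hHp]
  rw [Fin.sum_univ_two] at hp_sum
  linarith

theorem integral_eq_sum_setIntegral (hh : h 0 < h 1) (hp_sum : ∑ i, p i = 1)
    (hH : Measurable H) (hHp : ∀ i, Q.real {ω | H ω = h i} = p i) {g : Ω → ℝ}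
    (hg : Integrable g Q) : ∫ ω, g ω ∂Q = ∑ i, ∫ ω in {ω | H ω = h i}, g ω ∂Q := by
  rw [Fin.sum_univ_two, setIntegral_congr_set (payoff_ae hh hp_sum hH hHp),
    integral_add_compl (s := {ω | H ω = h 0}) (hH (measurableSet_singleton _)) hg]

/-- On `H = h i` the information is a shifted `β s`; independence of `H` from the bridge extracts `p
i`, and the shift is traded for the density. -/
theorem setIntegral_info (hs : 0 ≤ s) (hst : s ≤ t) (htT : t < T) (hH : Measurable H)
    (hHp : ∀ i, Q.real {ω | H ω = h i} = p i) (hβ : IsBrownianBridge β T Q)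
    (hindep : IndepFun H (fun ω (u : Set.Icc (0 : ℝ) T) ↦ β u ω) Q)
    {Ψ : (ℝ × (Set.Icc (0 : ℝ) s → ℝ)) × ℝ → ℝ} (hΨ : Measurable Ψ) {C : ℝ}
    (hC : ∀ x, |Ψ x| ≤ C) (i : Fin 2) :
    ∫ ω in {ω | H ω = h i}, Ψ ((info σ H β s ω, residual β s ω), innovation β T s t ω) ∂Q
      = ∫ b, weight σ T p h i s b * (∫ z, ∫ w, Ψ ((b, z), w)
          ∂gaussianReal 0 ((T - t) * (t - s) / (T - s)).toNNReal ∂Q.map (residual β s))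
          ∂gaussianReal 0 (s * (T - s) / T).toNNReal := by
  have hsT : s < T := hst.trans_lt htT
  have hE : MeasurableSet {ω | H ω = h i} := hH (measurableSet_singleton _)
  have h1 := hβ.measurable s ⟨hs, hsT.le⟩
  have h2 := hβ.measurable_residual hs hsT
  have h3 := hβ.measurable_innovation hs hst htT
  have : IsProbabilityMeasure (Q.map (residual β s)) :=
    Measure.isProbabilityMeasure_map h2.aemeasurable
  have hb : ∀ x, ‖Ψ x‖ ≤ C := hC
  let V : Ω → (ℝ × (Set.Icc (0 : ℝ) s → ℝ)) × ℝ := fun ω ↦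
    ((β s ω, residual β s ω), innovation β T s t ω)
  have hV : Measurable V := (h1.prodMk h2).prodMk h3
  let Ψ' : (ℝ × (Set.Icc (0 : ℝ) s → ℝ)) × ℝ → ℝ := fun x ↦
    Ψ ((σ * h i * s + x.1.1, x.1.2), x.2)
  have hΨ' : Measurable Ψ' := by fun_prop
  have hHV : IndepFun H V Q := by
    let s' : Set.Icc (0 : ℝ) T := ⟨s, hs, hsT.le⟩
    let t' : Set.Icc (0 : ℝ) T := ⟨t, hs.trans hst, htT.le⟩
    have hφ : Measurable fun x : Set.Icc (0 : ℝ) T → ℝ ↦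
        ((x s', fun u : Set.Icc (0 : ℝ) s ↦ x ⟨u, u.2.1, u.2.2.trans hsT.le⟩ - u / s * x s'),
          x t' - (T - t) / (T - s) * x s') := by
      refine Measurable.prodMk (Measurable.prodMk (by fun_prop)
        (measurable_pi_lambda _ fun u ↦ by fun_prop)) (by fun_prop)
    exact hindep.comp measurable_id hφ
  have hcongr : ∫ ω in {ω | H ω = h i},
        Ψ ((info σ H β s ω, residual β s ω), innovation β T s t ω) ∂Q
      = ∫ ω in {ω | H ω = h i}, Ψ' (V ω) ∂Q := by
    refine setIntegral_congr_fun hE fun ω hω ↦ ?_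
    have hω' : H ω = h i := hω
    simp only [info, hω', Ψ', V]
  have hprod : ∫ ω in {ω | H ω = h i}, Ψ' (V ω) ∂Q = p i * ∫ ω, Ψ' (V ω) ∂Q := by
    have hind : IndepFun (fun ω ↦ Set.indicator {h i} (1 : ℝ → ℝ) (H ω)) (fun ω ↦ Ψ' (V ω)) Q :=
      hHV.comp (measurable_one.indicator (measurableSet_singleton _)) hΨ'
    have h4 := hind.integral_fun_mul_eq_mul_integral
      (((measurable_one (α := ℝ) (β := ℝ)).indicator
        (measurableSet_singleton (h i))).comp hH).aestronglyMeasurable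
      (hΨ'.comp hV).aestronglyMeasurable
    have h5 : ∫ ω, Set.indicator {h i} (1 : ℝ → ℝ) (H ω) ∂Q = p i := by
      rw [← hHp i, ← integral_indicator_one hE]
      rfl
    rw [h5] at h4
    rw [← h4, ← integral_indicator hE]
    refine integral_congr_ae (.of_forall fun ω ↦ ?_)
    by_cases hω : H ω = h i <;> simp [Set.indicator, hω]
  have hint : Integrable Ψ' (((gaussianReal 0 (s * (T - s) / T).toNNReal).prod
      (Q.map (residual β s))).prod
        (gaussianReal 0 ((T - t) * (t - s) / (T - s)).toNNReal)) :=
    Integrable.of_bound hΨ'.aestronglyMeasurable C (.of_forall fun x ↦ hb _)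
  rw [hcongr, hprod, ← integral_map hV.aemeasurable hΨ'.aestronglyMeasurable,
    hβ.map_prod hs hst htT, integral_prod _ hint, integral_prod _ hint.integral_prod_left]
  exact integral_translate_eq_integral_weight hs hsT i fun b ↦ ∫ z, ∫ w, Ψ ((b, z), w)
          ∂gaussianReal 0 ((T - t) * (t - s) / (T - s)).toNNReal ∂Q.map (residual β s)

/-- The central Bayes formula: the innovation is integrated out against its own law. A constant `F`
gives the posteriors; an indicator `F` gives the exercise probabilities. -/
theorem condExp_indicator_payoff (hs : 0 ≤ s) (hst : s ≤ t) (htT : t < T) (hh : h 0 < h 1)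
    (hp : ∀ i, 0 < p i) (hp_sum : ∑ i, p i = 1) (hH : Measurable H)
    (hHp : ∀ i, Q.real {ω | H ω = h i} = p i) (hβ : IsBrownianBridge β T Q)
    (hindep : IndepFun H (fun ω (u : Set.Icc (0 : ℝ) T) ↦ β u ω) Q)
    {F : ℝ → ℝ → ℝ} (hF : Measurable fun x : ℝ × ℝ ↦ F x.1 x.2) {C : ℝ}
    (hC : ∀ x y, |F x y| ≤ C) (i : Fin 2) :
    Q[Set.indicator {ω | H ω = h i} (fun ω ↦ F (info σ H β s ω) (innovation β T s t ω)) |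
        marketInfo σ H β s] =ᵐ[Q]
      fun ω ↦ posterior σ T p h i s (info σ H β s ω) *
        ∫ w, F (info σ H β s ω) w
          ∂gaussianReal 0 ((T - t) * (t - s) / (T - s)).toNNReal := by
  have hsT : s < T := hst.trans_lt htT
  have hm := marketInfo_le (σ := σ) hH hβ.measurable hsT.le
  have hE : ∀ i, MeasurableSet {ω | H ω = h i} := fun i ↦ hH (measurableSet_singleton _)
  have hξ : Measurable (info σ H β s) := (measurable_info hs).mono hm le_rfl
  have hZ := hβ.measurable_residual hs hsT
  have hW := hβ.measurable_innovation hs hst htT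
  have : IsProbabilityMeasure (Q.map (residual β s)) :=
    Measure.isProbabilityMeasure_map hZ.aemeasurable
  set γ := gaussianReal 0 ((T - t) * (t - s) / (T - s)).toNNReal with hγ
  let m : ℝ → ℝ := fun y ↦ ∫ w, F y w ∂γ
  have hm_meas : Measurable m :=
    (StronglyMeasurable.integral_prod_right hF.stronglyMeasurable).measurable
  have hC0 : 0 ≤ C := (abs_nonneg _).trans (hC 0 0)
  have hm_bound : ∀ y, |m y| ≤ C := fun y ↦ by
    simpa using norm_integral_le_of_norm_le_const (μ := γ) (f := F y)
      (.of_forall fun w ↦ hC y w)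
  let g : ℝ → ℝ := fun y ↦ posterior σ T p h i s y * m y
  have hg_meas : Measurable g := by fun_prop
  have hg_bound : ∀ y, |g y| ≤ C := fun y ↦ by
    simp only [g, abs_mul, abs_of_pos (posterior_pos hp i s y)]
    calc _ ≤ 1 * C := mul_le_mul (posterior_le_one hp i s y) (hm_bound y) (abs_nonneg _) zero_le_one
      _ = C := one_mul C
  have hFint : Integrable (fun ω ↦ F (info σ H β s ω) (innovation β T s t ω)) Q :=
    .of_bound (hF.comp (hξ.prodMk hW)).aestronglyMeasurable C (.of_forall fun ω ↦ hC _ _)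
  have hgint : Integrable (fun ω ↦ g (info σ H β s ω)) Q :=
    .of_bound (hg_meas.comp hξ).aestronglyMeasurable C (.of_forall fun ω ↦ hg_bound _)
  refine (ae_eq_condExp_of_forall_setIntegral_eq hm (hFint.indicator (hE i))
    (fun A _ _ ↦ hgint.integrableOn) (fun A hA _ ↦ ?_)
    (hg_meas.comp (measurable_info hs)).aestronglyMeasurable).symm
  obtain ⟨S, hS, rfl⟩ := marketInfo_le_comap hs A hA
  have hA' := hm _ hA
  set A := (fun ω ↦ (info σ H β s ω, residual β s ω)) ⁻¹' S with hAdef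
  -- the section masses of the event
  let r : ℝ → ℝ := fun b ↦ ∫ z, Set.indicator S (fun _ ↦ (1 : ℝ)) (b, z) ∂Q.map (residual β s)
  have hr_meas : Measurable r :=
    (StronglyMeasurable.integral_prod_right'
      (measurable_const.indicator hS).stronglyMeasurable).measurable
  have hind : ∀ x, |Set.indicator S (fun _ ↦ (1 : ℝ)) x| ≤ 1 := fun x ↦ by
    by_cases hx : x ∈ S <;> simp [hx]
  have hr_bound : ∀ b, |r b| ≤ 1 := fun b ↦ by
    simpa using norm_integral_le_of_norm_le_const (μ := Q.map (residual β s))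
      (f := fun z ↦ S.indicator (fun _ ↦ (1 : ℝ)) (b, z))
      (.of_forall fun z ↦ hind (b, z))
  have hright : ∫ ω in A, Set.indicator {ω | H ω = h i}
        (fun ω ↦ F (info σ H β s ω) (innovation β T s t ω)) ω ∂Q
      = ∫ b, weight σ T p h i s b * (r b * m b) ∂gaussianReal 0 (s * (T - s) / T).toNNReal := by
    have h1 := setIntegral_info (σ := σ) hs hst htT hH hHp hβ hindep
      (Ψ := fun x ↦ S.indicator (fun _ ↦ 1) x.1 * F x.1.1 x.2)
      (((measurable_const.indicator hS).comp measurable_fst).mul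
        (hF.comp (measurable_fst.fst.prodMk measurable_snd)))
      (C := 1 * C) (fun x ↦ by
        rw [abs_mul]
        exact mul_le_mul (hind _) (hC _ _) (abs_nonneg _) zero_le_one) i
    simp only [integral_const_mul, integral_mul_const] at h1
    rw [← h1, setIntegral_indicator (hE i), Set.inter_comm, ← setIntegral_indicator hA']
    congr 1
    ext ω
    by_cases hω : (info σ H β s ω, residual β s ω) ∈ S <;> simp [Set.indicator, hAdef, hω]
  have hleft : ∀ j, ∫ ω in {ω | H ω = h j}, A.indicator (fun ω ↦ g (info σ H β s ω)) ω ∂Q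
      = ∫ b, weight σ T p h j s b * (r b * g b) ∂gaussianReal 0 (s * (T - s) / T).toNNReal := by
    intro j
    have h1 := setIntegral_info (σ := σ) hs hst htT hH hHp hβ hindep
      (Ψ := fun x ↦ S.indicator (fun _ ↦ 1) x.1 * g x.1.1)
      (((measurable_const.indicator hS).comp measurable_fst).mul
        (hg_meas.comp measurable_fst.fst))
      (C := 1 * C) (fun x ↦ by
        rw [abs_mul]
        exact mul_le_mul (hind _) (hg_bound _) (abs_nonneg _) zero_le_one) j
    simp only [integral_const, probReal_univ, one_smul, integral_mul_const] at h1
    rw [← h1]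
    congr 1
    ext ω
    by_cases hω : (info σ H β s ω, residual β s ω) ∈ S <;> simp [Set.indicator, hAdef, hω]
  -- The candidate is not confined to one payoff, so its integral sums over both; the total weight
  -- then cancels the denominator of the posterior.
  have hsplit := integral_eq_sum_setIntegral hh hp_sum hH hHp (hgint.indicator hA')
  rw [integral_indicator hA'] at hsplit
  rw [hright]
  refine hsplit.trans ?_
  simp only [hleft]
  rw [← integral_finsetSum]
  · refine integral_congr_ae (.of_forall fun b ↦ ?_)
    simp only [← sum_weight_mul_posterior hp i s b, Finset.sum_mul, g]
    exact Finset.sum_congr rfl fun j _ ↦ by ring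
  · intro j _
    refine (integrable_weight j s _).mul_bdd (c := 1 * C) (by fun_prop) (.of_forall fun b ↦ ?_)
    rw [norm_mul]
    exact mul_le_mul (hr_bound b) (hg_bound b) (norm_nonneg _) zero_le_one

end Conditional

/-! ### The normal distribution function and the limit at expiry. -/

theorem continuous_N : Continuous N := by
  refine continuous_iff_continuousAt.2 fun x ↦ ?_
  have h1 : (cdf (gaussianReal 0 1)).measure {x} = 0 := by
    rw [measure_cdf]
    have := nullSingletonClass_gaussianReal (μ := 0) (v := 1) one_ne_zero
    exact measure_singleton x
  rw [StieltjesFunction.measure_singleton, ENNReal.ofReal_eq_zero, sub_nonpos] at h1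
  have hm : Monotone (cdf (gaussianReal 0 1)) := monotone_cdf _
  refine hm.continuousAt_iff_leftLim_eq_rightLim.2 ?_
  rw [StieltjesFunction.rightLim_eq]
  exact le_antisymm (hm.leftLim_le le_rfl) h1

theorem real_gaussianReal_Ici {v : NNReal} (hv : 0 < v) (c : ℝ) :
    (gaussianReal 0 v).real (Set.Ici c) = N (-c / Real.sqrt v) := by
  have hr : 0 < Real.sqrt v := Real.sqrt_pos.2 (by exact_mod_cast hv)
  have h1 : (gaussianReal 0 1).map (fun x ↦ -Real.sqrt v * x) = gaussianReal 0 v := by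
    rw [gaussianReal_map_const_mul]
    congr 1
    · simp
    · ext
      simp
  rw [N, cdf_eq_real, ← h1, map_measureReal_apply (by fun_prop) measurableSet_Ici]
  congr 1
  ext x
  simp only [Set.mem_preimage, Set.mem_Ici, Set.mem_Iic, le_div_iff₀ hr]
  constructor <;> intro h <;> linarith

/-- The sign of `log (a₁ / a₀)` sends both arguments of `N` to the same infinity. If it vanishes,
both tend to `0` and the equal prefactors cancel. -/
theorem tendsto_blackScholes {a₀ a₁ : ℝ} (h₀ : 0 < a₀) (h₁ : 0 < a₁) :
    Tendsto (blackScholes a₀ a₁) (𝓝[>] 0) (𝓝 (max (a₁ - a₀) 0)) := by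
  have hc : Tendsto (fun c : ℝ ↦ 1 / 2 * c) (𝓝[>] 0) (𝓝 0) := by
    have : Tendsto (fun c : ℝ ↦ 1 / 2 * c) (𝓝 0) (𝓝 (1 / 2 * 0)) := by
      exact (continuous_const.mul continuous_id).tendsto 0
    rw [mul_zero] at this
    exact this.mono_left nhdsWithin_le_nhds
  have hc' : Tendsto (fun c : ℝ ↦ -(1 / 2 * c)) (𝓝[>] 0) (𝓝 0) := by simpa using hc.neg
  have hp : (fun c ↦ c⁻¹ * Real.log (a₁ / a₀) + 1 / 2 * c) =ᶠ[𝓝[>] 0] dPlus a₀ a₁ := by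
    filter_upwards [self_mem_nhdsWithin] with c hc
    have : c ≠ 0 := (Set.mem_Ioi.1 hc).ne'
    unfold dPlus
    field_simp
  have hm : (fun c ↦ c⁻¹ * Real.log (a₁ / a₀) + -(1 / 2 * c)) =ᶠ[𝓝[>] 0] dMinus a₀ a₁ := by
    filter_upwards [self_mem_nhdsWithin] with c hc
    have : c ≠ 0 := (Set.mem_Ioi.1 hc).ne'
    unfold dMinus
    field_simp
    ring
  have hinv : Tendsto (fun c : ℝ ↦ c⁻¹) (𝓝[>] 0) atTop := tendsto_inv_nhdsGT_zero
  rcases lt_trichotomy a₀ a₁ with hlt | rfl | hlt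
  · have hL : 0 < Real.log (a₁ / a₀) := Real.log_pos ((one_lt_div h₀).2 hlt)
    have hp' := (tendsto_cdf_atTop (gaussianReal 0 1)).comp
      (((hinv.atTop_mul_const hL).atTop_add hc).congr' hp)
    have hm' := (tendsto_cdf_atTop (gaussianReal 0 1)).comp
      (((hinv.atTop_mul_const hL).atTop_add hc').congr' hm)
    have := (hp'.const_mul a₁).sub (hm'.const_mul a₀)
    rw [mul_one, mul_one] at this
    rw [max_eq_left (by linarith)]
    exact this
  · simp only [div_self h₀.ne', Real.log_one, mul_zero, zero_add] at hp hm
    have hp' := (continuous_N.tendsto 0).comp (hc.congr' hp)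
    have hm' := (continuous_N.tendsto 0).comp (hc'.congr' hm)
    have := (hp'.const_mul a₀).sub (hm'.const_mul a₀)
    rw [sub_self] at this
    rw [sub_self, max_self]
    exact this
  · have hL : Real.log (a₁ / a₀) < 0 :=
      Real.log_neg (div_pos h₁ h₀) ((div_lt_one h₀).2 hlt)
    have hp' := (tendsto_cdf_atBot (gaussianReal 0 1)).comp
      (((hinv.atTop_mul_const_of_neg hL).atBot_add hc).congr' hp)
    have hm' := (tendsto_cdf_atBot (gaussianReal 0 1)).comp
      (((hinv.atTop_mul_const_of_neg hL).atBot_add hc').congr' hm)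
    have := (hp'.const_mul a₁).sub (hm'.const_mul a₀)
    rw [mul_zero, mul_zero, sub_zero] at this
    rw [max_eq_right (by linarith)]
    exact this

/-! ### The exercise region and its Gaussian probability. -/

section Threshold

variable {σ T s t A B : ℝ} {p h : Fin 2 → ℝ}

/-- The critical value of the information at time `t`: the posterior values `π₁ A` and `π₀ B`
agree there. -/
def threshold (σ T t A B : ℝ) (p h : Fin 2 → ℝ) : ℝ :=
  (T - t) / (T * σ * (h 1 - h 0)) * Real.log (p 0 * B / (p 1 * A)) + σ * t * (h 1 + h 0) / 2

/-- The normalising sum cancels, so the log-ratio is affine in `x`. It is used at `t` to locate the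
threshold and at `s` to recognise `dPlus` and `dMinus`. -/
theorem log_posterior_ratio (hp : ∀ i, 0 < p i) (hA : 0 < A) (hB : 0 < B) (u x : ℝ) :
    Real.log (posterior σ T p h 1 u x * A / (posterior σ T p h 0 u x * B))
      = T / (T - u) * (σ * (h 1 - h 0) * x - 1 / 2 * σ ^ 2 * (h 1 ^ 2 - h 0 ^ 2) * u)
        - Real.log (p 0 * B / (p 1 * A)) := by
  have hS := (sum_weight_pos (σ := σ) (T := T) (h := h) hp u x).ne'
  have h0 := (hp 0).ne'
  have h1 := (hp 1).ne'
  have h2 : posterior σ T p h 1 u x * A / (posterior σ T p h 0 u x * B)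
      = Real.exp (T / (T - u) * (σ * (h 1 - h 0) * x - 1 / 2 * σ ^ 2 * (h 1 ^ 2 - h 0 ^ 2) * u))
        / (p 0 * B / (p 1 * A)) := by
    have h3 : T / (T - u) * (σ * (h 1 - h 0) * x - 1 / 2 * σ ^ 2 * (h 1 ^ 2 - h 0 ^ 2) * u)
        = T / (T - u) * (σ * h 1 * x - 1 / 2 * σ ^ 2 * h 1 ^ 2 * u)
          - T / (T - u) * (σ * h 0 * x - 1 / 2 * σ ^ 2 * h 0 ^ 2 * u) := by ring
    rw [h3, Real.exp_sub]
    unfold posterior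
    set S := ∑ j, weight σ T p h j u x
    unfold weight
    field_simp
  rw [h2, Real.log_div (Real.exp_pos _).ne'
    (div_pos (mul_pos (hp 0) hB) (mul_pos (hp 1) hA)).ne', Real.log_exp]

theorem threshold_le_iff (hσ : 0 < σ) (ht : 0 ≤ t) (htT : t < T) (hh : h 0 < h 1)
    (hp : ∀ i, 0 < p i) (hA : 0 < A) (hB : 0 < B) (x : ℝ) :
    threshold σ T t A B p h ≤ x ↔
      posterior σ T p h 0 t x * B ≤ posterior σ T p h 1 t x * A := by
  have ha : 0 < posterior σ T p h 0 t x * B := mul_pos (posterior_pos hp 0 t x) hB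
  have hb : 0 < posterior σ T p h 1 t x * A := mul_pos (posterior_pos hp 1 t x) hA
  have hT : 0 < T := ht.trans_lt htT
  have hTt : 0 < T - t := by linarith
  have hδ : 0 < h 1 - h 0 := by linarith
  rw [← one_le_div ha, ← Real.log_nonneg_iff (div_pos hb ha), log_posterior_ratio hp hA hB,
    ← sub_nonneg, ← mul_nonneg_iff_of_pos_left (show 0 < T * σ * (h 1 - h 0) / (T - t) by positivity)]
  refine iff_of_eq (congrArg _ ?_)
  unfold threshold
  field_simp
  ring

/-- The level that the innovation has to reach for the option to be exercised, given the
information `y` at time `s` and the payoff `h i`. -/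
def exerciseLevel (σ T s t A B : ℝ) (p h : Fin 2 → ℝ) (i : Fin 2) (y : ℝ) : ℝ :=
  threshold σ T t A B p h - σ * h i * t - (T - t) / (T - s) * (y - σ * h i * s)

theorem sqrt_innovation_variance (hst : s < t) (htT : t < T) :
    Real.sqrt ((T - t) * (t - s) / (T - s)).toNNReal = (T - t) * vol T s t := by
  have h1 : 0 < T - t := by linarith
  have h2 : 0 < T - s := by linarith
  have h3 : 0 < t - s := by linarith
  rw [Real.coe_toNNReal _ (by positivity), vol,
    show (T - t) * (t - s) / (T - s) = (T - t) ^ 2 * ((t - s) / ((T - t) * (T - s))) by field_simp,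
    Real.sqrt_mul (by positivity), Real.sqrt_sq h1.le]

theorem vol_pos (hst : s < t) (htT : t < T) : 0 < vol T s t := by
  have h1 : 0 < T - t := by linarith
  have h2 : 0 < T - s := by linarith
  have h3 : 0 < t - s := by linarith
  exact Real.sqrt_pos.2 (by positivity)

theorem vol_sq (hst : s < t) (htT : t < T) :
    vol T s t ^ 2 = (t - s) / ((T - t) * (T - s)) := by
  have h1 : 0 < T - t := by linarith
  have h2 : 0 < T - s := by linarith
  have h3 : 0 < t - s := by linarith
  exact Real.sq_sqrt (by positivity)

/-- One computation serves both payoffs: measured from the midpoint in units of `h 1 - h 0`, `h i`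
is `±1/2`, the sign in `dPlus` and `dMinus`. -/
theorem exerciseLevel_eq (hσ : 0 < σ) (hs : 0 ≤ s) (hst : s < t) (htT : t < T)
    (hh : h 0 < h 1) (hp : ∀ i, 0 < p i) (hA : 0 < A) (hB : 0 < B) (i : Fin 2) (y : ℝ) :
    -exerciseLevel σ T s t A B p h i y / ((T - t) * vol T s t)
      = (Real.log (posterior σ T p h 1 s y * A / (posterior σ T p h 0 s y * B))
          + (h i - (h 1 + h 0) / 2) / (h 1 - h 0) * (σ * vol T s t * T * (h 1 - h 0)) ^ 2)
        / (σ * vol T s t * T * (h 1 - h 0)) := by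
  have hT : 0 < T := by linarith
  have h1 : 0 < T - t := by linarith
  have h2 : 0 < T - s := by linarith
  have hδ : 0 < h 1 - h 0 := by linarith
  have hv := vol_pos hst htT
  rw [log_posterior_ratio hp hA hB, mul_pow, mul_pow, mul_pow, vol_sq hst htT]
  unfold exerciseLevel threshold
  field_simp
  ring

theorem real_Ici_exerciseLevel_one (hσ : 0 < σ) (hs : 0 ≤ s) (hst : s < t) (htT : t < T)
    (hh : h 0 < h 1) (hp : ∀ i, 0 < p i) (hA : 0 < A) (hB : 0 < B) (y : ℝ) :
    (gaussianReal 0 ((T - t) * (t - s) / (T - s)).toNNReal).real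
        (Set.Ici (exerciseLevel σ T s t A B p h 1 y))
      = N (dPlus (posterior σ T p h 0 s y * B) (posterior σ T p h 1 s y * A)
          (σ * vol T s t * T * (h 1 - h 0))) := by
  have h1 : 0 < T - t := by linarith
  have h2 : 0 < T - s := by linarith
  have h3 : 0 < t - s := by linarith
  have hδ : h 1 - h 0 ≠ 0 := by linarith
  rw [real_gaussianReal_Ici (Real.toNNReal_pos.2 (by positivity)),
    sqrt_innovation_variance hst htT, exerciseLevel_eq hσ hs hst htT hh hp hA hB, dPlus,
    show (h 1 - (h 1 + h 0) / 2) / (h 1 - h 0) = 1 / 2 by field_simp; ring]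

theorem real_Ici_exerciseLevel_zero (hσ : 0 < σ) (hs : 0 ≤ s) (hst : s < t) (htT : t < T)
    (hh : h 0 < h 1) (hp : ∀ i, 0 < p i) (hA : 0 < A) (hB : 0 < B) (y : ℝ) :
    (gaussianReal 0 ((T - t) * (t - s) / (T - s)).toNNReal).real
        (Set.Ici (exerciseLevel σ T s t A B p h 0 y))
      = N (dMinus (posterior σ T p h 0 s y * B) (posterior σ T p h 1 s y * A)
          (σ * vol T s t * T * (h 1 - h 0))) := by
  have h1 : 0 < T - t := by linarith
  have h2 : 0 < T - s := by linarith
  have h3 : 0 < t - s := by linarith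
  have hδ : h 1 - h 0 ≠ 0 := by linarith
  rw [real_gaussianReal_Ici (Real.toNNReal_pos.2 (by positivity)),
    sqrt_innovation_variance hst htT, exerciseLevel_eq hσ hs hst htT hh hp hA hB, dMinus,
    show (h 0 - (h 1 + h 0) / 2) / (h 1 - h 0) = -(1 / 2) by field_simp; ring, neg_mul,
    ← sub_eq_add_neg]

end Threshold

theorem condExp_smul_add_smul {Ω : Type*} {m mΩ : MeasurableSpace Ω} {Q : Measure Ω}
    {f g : Ω → ℝ} (a b : ℝ) (hf : Integrable f Q) (hg : Integrable g Q) :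
    Q[a • f + b • g | m] =ᵐ[Q] a • Q[f | m] + b • Q[g | m] :=
  (condExp_add (hf.smul a) (hg.smul b) m).trans
    ((condExp_smul a f m).add (condExp_smul b g m))

/-! ### Bond and option prices. -/

section Pricing

variable {Ω : Type*} [MeasurableSpace Ω] {Q : Measure Ω} [IsProbabilityMeasure Q]
  {P₀ : ℝ → ℝ} {σ T s t K : ℝ} {h p : Fin 2 → ℝ} {H : Ω → ℝ} {β : ℝ → Ω → ℝ}

theorem condExp_indicator_eq_posterior (hs : 0 ≤ s) (hsT : s < T) (hh : h 0 < h 1)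
    (hp : ∀ i, 0 < p i) (hp_sum : ∑ i, p i = 1) (hH : Measurable H)
    (hHp : ∀ i, Q.real {ω | H ω = h i} = p i) (hβ : IsBrownianBridge β T Q)
    (hindep : IndepFun H (fun ω (u : Set.Icc (0 : ℝ) T) ↦ β u ω) Q) (i : Fin 2) :
    Q[Set.indicator {ω | H ω = h i} (fun _ ↦ (1 : ℝ)) | marketInfo σ H β s] =ᵐ[Q]
      fun ω ↦ posterior σ T p h i s (info σ H β s ω) := by
  have h1 := condExp_indicator_payoff (σ := σ) hs le_rfl hsT hh hp hp_sum hH hHp hβ hindep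
    (F := fun _ _ ↦ 1) measurable_const (C := 1) (fun _ _ ↦ by simp) i
  simpa using h1

theorem bondPrice_ae_eq (ht : 0 ≤ t) (htT : t < T) (hh : h 0 < h 1)
    (hp : ∀ i, 0 < p i) (hp_sum : ∑ i, p i = 1) (hH : Measurable H)
    (hHp : ∀ i, Q.real {ω | H ω = h i} = p i) (hβ : IsBrownianBridge β T Q)
    (hindep : IndepFun H (fun ω (u : Set.Icc (0 : ℝ) T) ↦ β u ω) Q) :
    bondPrice Q P₀ σ T H β t =ᵐ[Q] fun ω ↦ discount P₀ t T *
      (h 0 * posterior σ T p h 0 t (info σ H β t ω)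
        + h 1 * posterior σ T p h 1 t (info σ H β t ω)) := by
  have hX : ∀ i, Integrable (Set.indicator {ω | H ω = h i} (fun _ ↦ (1 : ℝ))) Q := fun i ↦
    (integrable_const 1).indicator (hH (measurableSet_singleton _))
  have hHX : H =ᵐ[Q] h 0 • Set.indicator {ω | H ω = h 0} (fun _ ↦ (1 : ℝ))
      + h 1 • Set.indicator {ω | H ω = h 1} (fun _ ↦ (1 : ℝ)) := by
    filter_upwards [payoff_ae hh hp_sum hH hHp] with ω hω
    have hω' : H ω = h 1 ↔ ¬ H ω = h 0 := iff_of_eq hω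
    by_cases h0 : H ω = h 0
    · simp [Set.indicator, h0, hh.ne]
    · simp [Set.indicator, hω'.2 h0, hh.ne']
  filter_upwards [(condExp_congr_ae (m := marketInfo σ H β t) hHX).trans
      (condExp_smul_add_smul (h 0) (h 1) (hX 0) (hX 1)),
    condExp_indicator_eq_posterior (σ := σ) ht htT hh hp hp_sum hH hHp hβ hindep 0,
    condExp_indicator_eq_posterior (σ := σ) ht htT hh hp hp_sum hH hHp hβ hindep 1] with ω h1 h2 h3
  rw [bondPrice, h1]
  simp [h2, h3]

theorem posterior_zero_add_one (hp : ∀ i, 0 < p i) (u x : ℝ) :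
    posterior σ T p h 0 u x + posterior σ T p h 1 u x = 1 := by
  have h1 := sum_weight_pos (σ := σ) (T := T) (h := h) hp u x
  rw [posterior, posterior, ← add_div, ← Fin.sum_univ_two (fun i ↦ weight σ T p h i u x),
    div_self h1.ne']

theorem bondPrice_sub_strike_ae_eq (ht : 0 ≤ t) (htT : t < T) (hh : h 0 < h 1)
    (hp : ∀ i, 0 < p i) (hp_sum : ∑ i, p i = 1) (hH : Measurable H)
    (hHp : ∀ i, Q.real {ω | H ω = h i} = p i) (hβ : IsBrownianBridge β T Q)
    (hindep : IndepFun H (fun ω (u : Set.Icc (0 : ℝ) T) ↦ β u ω) Q) :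
    ∀ᵐ ω ∂Q, bondPrice Q P₀ σ T H β t ω - K =
      posterior σ T p h 1 t (info σ H β t ω) * (discount P₀ t T * h 1 - K)
        - posterior σ T p h 0 t (info σ H β t ω) * (K - discount P₀ t T * h 0) := by
  filter_upwards [bondPrice_ae_eq (P₀ := P₀) (σ := σ) ht htT hh hp hp_sum hH hHp hβ hindep]
    with ω hω
  rw [hω]
  linear_combination K * posterior_zero_add_one (σ := σ) (T := T) (h := h) hp t (info σ H β t ω)

/-- The exercise event is known at `t`, so its indicator passes inside the conditional expectation.
This removes the positive part and prepares the tower property. -/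
theorem payoff_ae_eq_condExp (hσ : 0 < σ) (ht : 0 ≤ t) (htT : t < T) (hh : h 0 < h 1)
    (hp : ∀ i, 0 < p i) (hp_sum : ∑ i, p i = 1) (hH : Measurable H)
    (hHp : ∀ i, Q.real {ω | H ω = h i} = p i) (hβ : IsBrownianBridge β T Q)
    (hindep : IndepFun H (fun ω (u : Set.Icc (0 : ℝ) T) ↦ β u ω) Q)
    (hK₀ : discount P₀ t T * h 0 < K) (hK₁ : K < discount P₀ t T * h 1) :
    (fun ω ↦ max (bondPrice Q P₀ σ T H β t ω - K) 0) =ᵐ[Q]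
      Q[(info σ H β t ⁻¹' Set.Ici (threshold σ T t (discount P₀ t T * h 1 - K)
            (K - discount P₀ t T * h 0) p h)).indicator
          ((discount P₀ t T * h 1 - K) • Set.indicator {ω | H ω = h 1} (fun _ ↦ (1 : ℝ))
            + (-(K - discount P₀ t T * h 0)) •
              Set.indicator {ω | H ω = h 0} (fun _ ↦ (1 : ℝ))) |
        marketInfo σ H β t] := by
  set A := discount P₀ t T * h 1 - K
  set B := K - discount P₀ t T * h 0
  have hA : 0 < A := sub_pos.2 hK₁
  have hB : 0 < B := sub_pos.2 hK₀
  have hX : ∀ i, Integrable (Set.indicator {ω | H ω = h i} (fun _ ↦ (1 : ℝ))) Q := fun i ↦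
    (integrable_const 1).indicator (hH (measurableSet_singleton _))
  have hD : MeasurableSet[marketInfo σ H β t] (info σ H β t ⁻¹' Set.Ici (threshold σ T t A B p h)) :=
    measurable_info ht measurableSet_Ici
  filter_upwards [bondPrice_sub_strike_ae_eq (P₀ := P₀) (σ := σ) (K := K) ht htT hh hp hp_sum hH
      hHp hβ hindep,
    condExp_indicator (m := marketInfo σ H β t) (((hX 1).smul A).add ((hX 0).smul (-B))) hD,
    condExp_smul_add_smul (m := marketInfo σ H β t) A (-B) (hX 1) (hX 0),
    condExp_indicator_eq_posterior (σ := σ) ht htT hh hp hp_sum hH hHp hβ hindep 0,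
    condExp_indicator_eq_posterior (σ := σ) ht htT hh hp hp_sum hH hHp hβ hindep 1]
    with ω h1 h2 h3 h4 h5
  have h6 := threshold_le_iff hσ ht htT hh hp hA hB (info σ H β t ω)
  rw [h1, h2]
  by_cases hω : ω ∈ info σ H β t ⁻¹' Set.Ici (threshold σ T t A B p h)
  · rw [Set.indicator_of_mem hω, h3, max_eq_left (sub_nonneg.2 (h6.1 hω))]
    simp only [Pi.add_apply, Pi.smul_apply, h4, h5, smul_eq_mul]
    ring
  · rw [Set.indicator_of_notMem hω, max_eq_right]
    exact sub_nonpos.2 (not_le.1 fun h7 ↦ hω (h6.2 h7)).le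

theorem condExp_indicator_exercise (hs : 0 ≤ s) (hst : s ≤ t) (htT : t < T) (hh : h 0 < h 1)
    (hp : ∀ i, 0 < p i) (hp_sum : ∑ i, p i = 1) (hH : Measurable H)
    (hHp : ∀ i, Q.real {ω | H ω = h i} = p i) (hβ : IsBrownianBridge β T Q)
    (hindep : IndepFun H (fun ω (u : Set.Icc (0 : ℝ) T) ↦ β u ω) Q) (A B : ℝ) (i : Fin 2) :
    Q[(info σ H β t ⁻¹' Set.Ici (threshold σ T t A B p h)).indicator
        (Set.indicator {ω | H ω = h i} (fun _ ↦ (1 : ℝ))) | marketInfo σ H β s] =ᵐ[Q]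
      fun ω ↦ posterior σ T p h i s (info σ H β s ω) *
        (gaussianReal 0 ((T - t) * (t - s) / (T - s)).toNNReal).real
          (Set.Ici (exerciseLevel σ T s t A B p h i (info σ H β s ω))) := by
  let S : Set (ℝ × ℝ) := {x | exerciseLevel σ T s t A B p h i x.1 ≤ x.2}
  have hS : MeasurableSet S := by
    refine measurableSet_le ?_ measurable_snd
    unfold exerciseLevel
    fun_prop
  have h1 := condExp_indicator_payoff (σ := σ) hs hst htT hh hp hp_sum hH hHp hβ hindep
    (F := fun x y ↦ S.indicator (fun _ ↦ 1) (x, y)) (measurable_const.indicator hS) (C := 1)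
    (fun x y ↦ by by_cases hx : (x, y) ∈ S <;> simp [hx]) i
  have h2 : (info σ H β t ⁻¹' Set.Ici (threshold σ T t A B p h)).indicator
        (Set.indicator {ω | H ω = h i} (fun _ ↦ (1 : ℝ)))
      = Set.indicator {ω | H ω = h i} fun ω ↦
        S.indicator (fun _ ↦ (1 : ℝ)) (info σ H β s ω, innovation β T s t ω) := by
    ext ω
    by_cases hω : H ω = h i
    · have h3 : threshold σ T t A B p h ≤ info σ H β t ω ↔
          exerciseLevel σ T s t A B p h i (info σ H β s ω) ≤ innovation β T s t ω := by
        simp only [info, exerciseLevel, innovation, hω]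
        rw [← sub_nonneg, ← sub_nonneg (b := threshold σ T t A B p h - _ - _)]
        refine iff_of_eq (congrArg _ ?_)
        ring
      simp [Set.indicator, hω, S, h3]
    · simp [Set.indicator, hω]
  rw [h2]
  refine h1.trans (.of_forall fun ω ↦ ?_)
  dsimp only
  rw [← integral_indicator_one measurableSet_Ici]
  rfl

theorem callPrice_ae_eq (hσ : 0 < σ) (hs : 0 ≤ s) (hst : s < t) (htT : t < T) (hh : h 0 < h 1)
    (hp : ∀ i, 0 < p i) (hp_sum : ∑ i, p i = 1) (hH : Measurable H)
    (hHp : ∀ i, Q.real {ω | H ω = h i} = p i) (hβ : IsBrownianBridge β T Q)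
    (hindep : IndepFun H (fun ω (u : Set.Icc (0 : ℝ) T) ↦ β u ω) Q)
    (hK₀ : discount P₀ t T * h 0 < K) (hK₁ : K < discount P₀ t T * h 1) :
    ∀ᵐ ω ∂Q, callPrice Q P₀ σ T H β K t s ω =
      discount P₀ s t * blackScholes
        (posterior σ T p h 0 s (info σ H β s ω) * (K - discount P₀ t T * h 0))
        (posterior σ T p h 1 s (info σ H β s ω) * (discount P₀ t T * h 1 - K))
        (σ * vol T s t * T * (h 1 - h 0)) := by
  have h1 := condExp_congr_ae (m := marketInfo σ H β s)
    (payoff_ae_eq_condExp (P₀ := P₀) hσ (hs.trans hst.le) htT hh hp hp_sum hH hHp hβ hindep hK₀ hK₁)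
  have h2 := h1.trans (condExp_condExp_of_le (marketInfo_mono hst.le)
    (marketInfo_le (σ := σ) hH hβ.measurable htT.le))
  set A := discount P₀ t T * h 1 - K
  set B := K - discount P₀ t T * h 0
  have hA : 0 < A := sub_pos.2 hK₁
  have hB : 0 < B := sub_pos.2 hK₀
  have hX : ∀ i, Integrable ((info σ H β t ⁻¹' Set.Ici (threshold σ T t A B p h)).indicator
      (Set.indicator {ω | H ω = h i} (fun _ ↦ (1 : ℝ)))) Q := fun i ↦
    ((integrable_const 1).indicator (hH (measurableSet_singleton _))).indicator
      (marketInfo_le (σ := σ) hH hβ.measurable htT.le _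
        (measurable_info (hs.trans hst.le) measurableSet_Ici))
  have hsmul : ∀ (D : Set Ω) (c : ℝ) (f : Ω → ℝ), D.indicator (c • f) = c • D.indicator f :=
    fun D c f ↦ Set.indicator_const_smul D c f
  rw [Set.indicator_add', hsmul, hsmul] at h2
  filter_upwards [h2, condExp_smul_add_smul (m := marketInfo σ H β s) A (-B) (hX 1) (hX 0),
    condExp_indicator_exercise (σ := σ) hs hst.le htT hh hp hp_sum hH hHp hβ hindep A B 0,
    condExp_indicator_exercise (σ := σ) hs hst.le htT hh hp hp_sum hH hHp hβ hindep A B 1]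
    with ω h3 h4 h5 h6
  rw [callPrice, h3, h4, Pi.add_apply, Pi.smul_apply, Pi.smul_apply, h5, h6,
    real_Ici_exerciseLevel_one hσ hs hst htT hh hp hA hB,
    real_Ici_exerciseLevel_zero hσ hs hst htT hh hp hA hB, blackScholes, smul_eq_mul, smul_eq_mul]
  ring

theorem callPrice_expiry_ae_eq (hH : Measurable H) (hβ : IsBrownianBridge β T Q)
    (htT : t ≤ T) : callPrice Q P₀ σ T H β K t t =ᵐ[Q]
      fun ω ↦ discount P₀ t t * max (bondPrice Q P₀ σ T H β t ω - K) 0 := by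
  have hm : StronglyMeasurable[marketInfo σ H β t]
      fun ω ↦ max (bondPrice Q P₀ σ T H β t ω - K) 0 :=
    Continuous.comp_stronglyMeasurable (g := fun x ↦ max (discount P₀ t T * x - K) 0)
      (by fun_prop) stronglyMeasurable_condExp
  have hi : Integrable (fun ω ↦ max (bondPrice Q P₀ σ T H β t ω - K) 0) Q :=
    ((integrable_condExp.const_mul _).sub (integrable_const K)).sup (integrable_const 0)
  refine .of_forall fun ω ↦ ?_
  rw [callPrice, condExp_of_stronglyMeasurable (marketInfo_le hH hβ.measurable htT) hm hi]

end Pricing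

end BinaryBond

end

theorem mainTheorem2 {Ω : Type*} [MeasurableSpace Ω] (Q : Measure Ω) [IsProbabilityMeasure Q]
    (P₀ : ℝ → ℝ) (hP₀ : BinaryBond.IsDiscountFunction P₀)
    (σ T t K : ℝ) (hσ : 0 < σ) (ht : 0 ≤ t) (htT : t < T)
    (h p : Fin 2 → ℝ) (hh : h 0 < h 1) (hp : ∀ i, 0 < p i) (hp_sum : ∑ i, p i = 1)
    (H : Ω → ℝ) (hH : Measurable H) (hHp : ∀ i, Q.real {ω | H ω = h i} = p i)
    (β : ℝ → Ω → ℝ) (hβ : BinaryBond.IsBrownianBridge β T Q)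
    (hindep : IndepFun H (fun ω (u : Set.Icc (0 : ℝ) T) ↦ β u ω) Q)
    (hK₀ : BinaryBond.discount P₀ t T * h 0 < K)
    (hK₁ : K < BinaryBond.discount P₀ t T * h 1) :
    -- the explicit `π_{is}` are the posterior probabilities of the payoffs
    (∀ s, 0 ≤ s → s ≤ t → ∀ i,
      Q[Set.indicator {ω | H ω = h i} (fun _ ↦ (1 : ℝ)) | BinaryBond.marketInfo σ H β s] =ᵐ[Q]
        fun ω ↦ BinaryBond.posterior σ T p h i s (BinaryBond.info σ H β s ω)) ∧
    -- the option price at times `s < t`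
    (∀ s, 0 ≤ s → s < t → ∀ᵐ ω ∂Q,
      BinaryBond.callPrice Q P₀ σ T H β K t s ω =
        BinaryBond.discount P₀ s t * BinaryBond.blackScholes
          (BinaryBond.posterior σ T p h 0 s (BinaryBond.info σ H β s ω) *
            (K - BinaryBond.discount P₀ t T * h 0))
          (BinaryBond.posterior σ T p h 1 s (BinaryBond.info σ H β s ω) *
            (BinaryBond.discount P₀ t T * h 1 - K))
          (σ * BinaryBond.vol T s t * T * (h 1 - h 0))) ∧
    -- at `s = t`, where `v_{tt} = 0`, the formula is read as the limit for `v ↓ 0`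
    (∀ᵐ ω ∂Q,
      Tendsto (fun v : ℝ ↦ BinaryBond.discount P₀ t t * BinaryBond.blackScholes
          (BinaryBond.posterior σ T p h 0 t (BinaryBond.info σ H β t ω) *
            (K - BinaryBond.discount P₀ t T * h 0))
          (BinaryBond.posterior σ T p h 1 t (BinaryBond.info σ H β t ω) *
            (BinaryBond.discount P₀ t T * h 1 - K))
          (σ * v * T * (h 1 - h 0)))
        (𝓝[>] 0) (𝓝 (BinaryBond.callPrice Q P₀ σ T H β K t t ω))) := by
  have hT : 0 < T := ht.trans_lt htT
  refine ⟨fun s hs hst i ↦ BinaryBond.condExp_indicator_eq_posterior hs (hst.trans_lt htT) hh hp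
      hp_sum hH hHp hβ hindep i,
    fun s hs hst ↦ BinaryBond.callPrice_ae_eq hσ hs hst htT hh hp hp_sum hH hHp hβ hindep hK₀ hK₁,
    ?_⟩
  filter_upwards [BinaryBond.callPrice_expiry_ae_eq (P₀ := P₀) (σ := σ) (K := K) hH hβ htT.le,
    BinaryBond.bondPrice_sub_strike_ae_eq (P₀ := P₀) (σ := σ) (K := K) ht htT hh hp hp_sum hH hHp hβ
      hindep] with ω h1 h2
  rw [h1, h2]
  -- The limit in `v` is the limit in `c = σ v T (h 1 - h 0)`, a positive multiple of `v`.
  refine Tendsto.const_mul _ ((BinaryBond.tendsto_blackScholes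
    (mul_pos (BinaryBond.posterior_pos hp 0 t _) (sub_pos.2 hK₀))
    (mul_pos (BinaryBond.posterior_pos hp 1 t _) (sub_pos.2 hK₁))).comp ?_)
  have hk : 0 < σ * T * (h 1 - h 0) := mul_pos (mul_pos hσ hT) (sub_pos.2 hh)
  refine tendsto_nhdsWithin_iff.2 ⟨?_, ?_⟩
  · have h3 : Tendsto (fun v : ℝ ↦ σ * v * T * (h 1 - h 0)) (𝓝 0)
        (𝓝 (σ * 0 * T * (h 1 - h 0))) := by
      exact Continuous.tendsto (by fun_prop) 0
    rw [mul_zero, zero_mul, zero_mul] at h3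
    exact h3.mono_left nhdsWithin_le_nhds
  · filter_upwards [self_mem_nhdsWithin] with v hv
    have h4 : σ * v * T * (h 1 - h 0) = v * (σ * T * (h 1 - h 0)) := by ring
    rw [h4]
    exact mul_pos hv hk
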